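/- Let $\mu$ denote the Möbius function. For every sequence of real numbers $\tau(N)\to 0$ (in particular, for every decreasing, strictly positive one) there are a compact metric space $X$ and a continuous map $T:X\to X$ of zero topological entropy such that: (i) $(X,T)$ satisfies Sarnak's Möbius disjointness conjecture, that is, $\frac1N\sum_{n=1}^N\mu(n)f(T^nx)\to 0$ as $N\to\infty$ for every continuous $f:X\to\mathbb R$ and every $x\in X$; (ii) the decay in (i) does not take place at rate $\tau$: there are a point $x\in X$ and a continuous function $f:X\to\mathbb R$ such that $$\frac1N\sum_{n=1}^N\mu(n)f(T^nx)\ \neq\ O(\tau(N))\qquad (N\to\infty).$$ Consequently no rate of decay, even with a constant depending on $X$, $T$, $f$ and $x$, holds for all zero entropy systems in Sarnak's conjecture. -/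

import Mathlib

open Filter Topology Asymptotics

/-- The Cesàro average `(1/N) * ∑_{n=1}^N μ(n) f(T^n x)`, with `μ` the Möbius function. -/
noncomputable def moebiusAverage {X : Type*} (T : X → X) (f : X → ℝ) (x : X) (N : ℕ) : ℝ :=
  (1 / (N : ℝ)) *
    ∑ n ∈ Finset.Icc 1 N, ((ArithmeticFunction.moebius n : ℤ) : ℝ) * f (T^[n] x)

/-- The topological entropy (in the sense of Bowen) of `(X, T)` is zero. -/
def HasZeroEntropy {X : Type*} [UniformSpace X] (T : X → X) : Prop :=
  Dynamics.coverEntropy T Set.univ = 0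

/-- The system `(X, T)` satisfies the conclusion of Sarnak's Möbius disjointness conjecture. -/
def MoebiusDisjoint {X : Type*} [TopologicalSpace X] (T : X → X) : Prop :=
  ∀ (f : C(X, ℝ)) (x : X), Tendsto (fun N : ℕ => moebiusAverage T f x N) atTop (𝓝 0)

open MeasureTheory FourierTransform

/-! ### Systems all of whose orbits converge to a fixed point -/

/-! On `ℕ∞` with `n ↦ n + 1`, every orbit tends to `⊤`. This forces zero entropy and, by Cesàro,
reduces Möbius disjointness to `M(N) = o(N)`. Take `f(n) = μ(n) ε(n)`, `f(⊤) = 0`, with `ε`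
decreasing to `0`: `f` is continuous, and from `x = 0` the average is `(1/N) ∑ μ(n)² ε(n) ≥ ε(N)/4`,
since a quarter of the integers are squarefree. If `|τ| ≤ ε²`, this is not `O(τ)`.

The deep input is `M(x) = o(x)`. Put `h(u) = e^u M(e^{-u})`. The Fourier transform of `e^{σu} h(u)`
is `1/(s ζ(s))` on `Re s = 1 + σ`, continuous up to `σ = 0` because `ζ` has no zeros on `Re s = 1`.
Riemann–Lebesgue then makes smoothed averages of `h` vanish at `-∞`, and slow variation of `h`
removes the smoothing (`tendsto_zero_of_fourier_boundary`). -/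

theorem moebiusAverage_eq_range {X : Type*} (T : X → X) (f : X → ℝ) (x : X) (N : ℕ) :
    moebiusAverage T f x N = (N : ℝ)⁻¹ *
      ∑ n ∈ Finset.range N, ((ArithmeticFunction.moebius (n + 1) : ℤ) : ℝ) * f (T^[n + 1] x) := by
  rw [moebiusAverage, one_div, Finset.range_eq_Ico, Finset.sum_Ico_add'
    (fun n : ℕ => ((ArithmeticFunction.moebius n : ℤ) : ℝ) * f (T^[n] x)), zero_add]
  rfl

/-- If the Mertens function is `o(N)` and every orbit of `T` converges to a common point, then
`T` is Möbius disjoint. -/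
theorem MoebiusDisjoint.of_tendsto_iterate {X : Type*} [TopologicalSpace X] {T : X → X} {z : X}
    (hT : ∀ x, Tendsto (fun n => T^[n] x) atTop (𝓝 z))
    (hM : Tendsto (fun N : ℕ => (N : ℝ)⁻¹ *
      ∑ n ∈ Finset.range N, ((ArithmeticFunction.moebius (n + 1) : ℤ) : ℝ)) atTop (𝓝 0)) :
    MoebiusDisjoint T := by
  intro f x
  have hf : Tendsto (fun n => f (T^[n + 1] x) - f z) atTop (𝓝 0) := by
    have := ((f.continuous.tendsto z).comp (hT x)).comp (tendsto_add_atTop_nat 1)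
    simpa [Function.comp_def] using this.sub_const (f z)
  have hμ : Tendsto (fun n : ℕ => ((ArithmeticFunction.moebius (n + 1) : ℤ) : ℝ) *
      (f (T^[n + 1] x) - f z)) atTop (𝓝 0) := by
    refine squeeze_zero_norm (fun n => ?_) (tendsto_zero_iff_norm_tendsto_zero.1 hf)
    rw [norm_mul]
    refine mul_le_of_le_one_left (norm_nonneg _) ?_
    rw [Real.norm_eq_abs]
    exact_mod_cast ArithmeticFunction.abs_moebius_le_one
  have h := hμ.cesaro.add (hM.mul_const (f z))
  simp only [zero_mul, add_zero] at h
  refine h.congr fun N => ?_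
  rw [moebiusAverage_eq_range, mul_assoc, ← mul_add, Finset.sum_mul, ← Finset.sum_add_distrib]
  congr 1
  exact Finset.sum_congr rfl fun n _ => by ring

/-! ### The translation on the one-point compactification of the naturals -/

/-- The translation `n ↦ n + 1` on `ℕ∞`. -/
def ENat.succMap : C(ℕ∞, ℕ∞) := ⟨fun n => n + 1, by fun_prop⟩

theorem ENat.succMap_iterate (k : ℕ) (n : ℕ∞) : ENat.succMap^[k] n = n + k := by
  induction k with
  | zero => simp
  | succ k ih => rw [Function.iterate_succ_apply', ih]; simp [ENat.succMap, add_assoc]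

theorem ENat.tendsto_succMap_iterate (n : ℕ∞) :
    Tendsto (fun k => ENat.succMap^[k] n) atTop (𝓝 ⊤) := by
  simp_rw [ENat.succMap_iterate]
  simpa using (tendsto_const_nhds (x := n)).add ENat.tendsto_natCast_nhds_top

/-- One finite set is a dynamical cover for all times: `⊤` shadows every `n ≥ m`, and each of the
finitely many other points shadows itself. The uniformity is left free so that the one from a chosen
metric can be used. -/
theorem ENat.coverEntropy_succMap [u : UniformSpace ℕ∞]
    (hu : u.toTopologicalSpace = ENat.instTopologicalSpace) :
    Dynamics.coverEntropy ENat.succMap Set.univ = 0 := by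
  refine le_antisymm (iSup₂_le fun U hU => ?_)
    (Dynamics.coverEntropy_nonneg _ Set.univ_nonempty)
  have hball : {n : ℕ∞ | (n, ⊤) ∈ U} ∈ @nhds ℕ∞ u.toTopologicalSpace ⊤ := mem_nhds_right _ hU
  rw [hu] at hball
  obtain ⟨m, hm⟩ : ∃ m : ℕ, ∀ n : ℕ∞, (m : ℕ∞) ≤ n → (n, ⊤) ∈ U := by
    obtain ⟨a, ha, h⟩ := exists_Ioc_subset_of_mem_nhds hball ⟨0, ENat.top_pos⟩
    lift a to ℕ using ha.ne
    refine ⟨a + 1, fun n hn => h ⟨?_, le_top⟩⟩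
    exact lt_of_lt_of_le (by exact_mod_cast a.lt_succ_self) hn
  set s : Finset ℕ∞ := insert ⊤ ((Finset.range m).image Nat.cast)
  have hcov (n : ℕ) : Dynamics.IsDynCoverOf ENat.succMap Set.univ U n (s : Set ℕ∞) := by
    intro x _
    by_cases hx : (m : ℕ∞) ≤ x
    · refine ⟨⊤, by simp [s], Dynamics.mem_dynEntourage.2 fun k _ => ?_⟩
      rw [ENat.succMap_iterate, ENat.succMap_iterate, top_add]
      exact hm _ (hx.trans le_self_add)
    · refine ⟨x, ?_, Dynamics.mem_dynEntourage.2 fun k _ => refl_mem_uniformity hU⟩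
      rw [not_le] at hx
      lift x to ℕ using (hx.trans_le le_top).ne
      simpa [s] using hx
  have hs : (s.card : ENNReal) ≠ 0 := by simp [s]
  calc Dynamics.coverEntropyEntourage ENat.succMap Set.univ U
      ≤ ExpGrowth.expGrowthSup (fun _ => (s.card : ENNReal)) :=
        ExpGrowth.expGrowthSup_monotone fun n => by
          simpa using ENat.toENNReal_mono (hcov n).coverMincard_le_card
    _ = 0 := ExpGrowth.expGrowthSup_const hs (by simp)

/-- The continuous function on `ℕ∞` with values `a n` on `ℕ` and `0` at infinity. -/
noncomputable def ENat.extendByZero (a : ℕ → ℝ) (ha : Tendsto a atTop (𝓝 0)) : C(ℕ∞, ℝ) where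
  toFun n := if n = ⊤ then 0 else a n.toNat
  continuous_toFun := by
    rw [continuous_iff_continuousAt]
    intro n
    rcases eq_or_ne n ⊤ with rfl | hn
    · rw [ContinuousAt, if_pos rfl, Metric.tendsto_nhds]
      intro ε hε
      obtain ⟨m, hm⟩ := eventually_atTop.1 (Metric.tendsto_nhds.1 ha ε hε)
      filter_upwards [lt_mem_nhds (ENat.natCast_lt_top m)] with k hk
      split_ifs with h
      · simpa using hε
      · lift k to ℕ using h
        exact hm _ (by exact_mod_cast hk.le)
    · rw [ContinuousAt, ENat.nhds_eq_pure hn]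
      exact tendsto_pure_nhds _ _

@[simp] theorem ENat.extendByZero_natCast (a : ℕ → ℝ) (ha : Tendsto a atTop (𝓝 0)) (n : ℕ) :
    ENat.extendByZero a ha n = a n := by
  simp [ENat.extendByZero]

/-! ### Counting squarefree numbers -/

/-- At least a quarter of the integers in `[1, N]` are squarefree. -/
theorem Nat.div_four_le_sum_sq_moebius (N : ℕ) :
    (N : ℝ) / 4 ≤
      ∑ n ∈ Finset.range N, ((ArithmeticFunction.moebius (n + 1) : ℤ) : ℝ) ^ 2 := by
  have hsum (K : ℕ) : ∑ k ∈ Finset.range K, (1 : ℝ) / ((k : ℝ) + 2) ^ 2 ≤ 3 / 4 := by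
    -- Telescoping: `1/(k+2)² ≤ 1/(k+3/2) - 1/(k+5/2)`, with initial value `2/3 ≤ 3/4`.
    suffices h : ∑ k ∈ Finset.range K, (1 : ℝ) / ((k : ℝ) + 2) ^ 2 +
        (1 : ℝ) / (K + 3 / 2) ≤ 3 / 4 from le_trans (le_add_of_nonneg_right (by positivity)) h
    induction K with
    | zero => norm_num
    | succ K ih =>
      rw [Finset.sum_range_succ]
      refine le_trans ?_ ih
      rw [add_assoc]
      gcongr
      rw [div_add_div _ _ (by positivity) (by positivity),
        div_le_div_iff₀ (by positivity) (by positivity)]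
      push_cast
      nlinarith
  have hcount : N ≤ ({n ∈ Finset.range N | Squarefree (n + 1)}).card +
      ∑ k ∈ Finset.range N, N / (k + 2) ^ 2 := by
    have hsub : Finset.range N ⊆ {n ∈ Finset.range N | Squarefree (n + 1)} ∪
        (Finset.range N).biUnion fun k => {n ∈ Finset.range N | (k + 2) ^ 2 ∣ n + 1} := by
      intro n hn
      by_cases h : Squarefree (n + 1)
      · exact Finset.mem_union_left _ (by simp_all)
      · refine Finset.mem_union_right _ ?_
        rw [Nat.squarefree_iff_prime_squarefree] at h
        push Not at h
        obtain ⟨p, hp, hd⟩ := h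
        have hp2 := hp.two_le
        have hpn : p * p ≤ n + 1 := Nat.le_of_dvd n.succ_pos hd
        rw [Finset.mem_range] at hn
        simp only [Finset.mem_biUnion, Finset.mem_range, Finset.mem_filter]
        refine ⟨p - 2, by nlinarith [Nat.sub_add_cancel hp2], hn, ?_⟩
        rwa [Nat.sub_add_cancel hp2, sq]
    have h1 := (Finset.card_le_card hsub).trans
      ((Finset.card_union_le _ _).trans (Nat.add_le_add_left Finset.card_biUnion_le _))
    simpa only [Finset.card_range, Nat.card_multiples] using h1
  have heq : ∑ n ∈ Finset.range N, ((ArithmeticFunction.moebius (n + 1) : ℤ) : ℝ) ^ 2 =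
      ({n ∈ Finset.range N | Squarefree (n + 1)}).card := by
    rw [Finset.card_filter, Nat.cast_sum]
    refine Finset.sum_congr rfl fun n _ => ?_
    split_ifs with h
    · rw [ArithmeticFunction.moebius_apply_of_squarefree h]
      push_cast
      rw [← pow_mul, mul_comm, pow_mul]
      simp
    · simp [ArithmeticFunction.moebius_eq_zero_of_not_squarefree h]
  have hreal : (N : ℝ) ≤ ({n ∈ Finset.range N | Squarefree (n + 1)}).card +
      N * ∑ k ∈ Finset.range N, (1 : ℝ) / ((k : ℝ) + 2) ^ 2 := by
    refine (Nat.cast_le.2 hcount).trans ?_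
    rw [Finset.mul_sum, Nat.cast_add, Nat.cast_sum]
    gcongr with k _
    refine Nat.cast_div_le.trans (le_of_eq ?_)
    push_cast
    ring
  rw [heq]
  nlinarith [hsum N, (N.cast_nonneg : (0 : ℝ) ≤ N)]

/-- A null sequence has an antitone, positive, null majorant of its square root. -/
theorem exists_antitone_sq_ge_of_tendsto_zero {τ : ℕ → ℝ} (hτ : Tendsto τ atTop (𝓝 0)) :
    ∃ ε : ℕ → ℝ, Antitone ε ∧ (∀ n, 0 < ε n) ∧ Tendsto ε atTop (𝓝 0) ∧
      ∀ n, |τ n| ≤ ε n ^ 2 := by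
  have hb : BddAbove (Set.range fun n => |τ n|) := by
    simpa using hτ.abs.bddAbove_range
  have hbn (n : ℕ) : BddAbove (Set.range fun k => |τ (n + k)|) :=
    hb.mono (by rintro _ ⟨k, rfl⟩; exact ⟨n + k, rfl⟩)
  set σ : ℕ → ℝ := fun n => ⨆ k, |τ (n + k)|
  have hle (n) : |τ n| ≤ σ n := le_ciSup (hbn n) 0
  have h0 (n) : 0 ≤ σ n := (abs_nonneg _).trans (hle n)
  have hanti : Antitone σ := fun n m h => ciSup_le fun k => by
    obtain ⟨j, rfl⟩ := Nat.exists_eq_add_of_le h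
    simpa [add_assoc] using le_ciSup (hbn n) (j + k)
  have hlim : Tendsto σ atTop (𝓝 0) := by
    rw [Metric.tendsto_atTop]
    intro δ hδ
    obtain ⟨m, hm⟩ := Metric.tendsto_atTop.1 hτ (δ / 2) (half_pos hδ)
    refine ⟨m, fun n hn => ?_⟩
    rw [Real.dist_0_eq_abs, abs_of_nonneg (h0 n)]
    refine lt_of_le_of_lt (ciSup_le fun k => ?_) (half_lt_self hδ)
    simpa using (hm (n + k) (by omega)).le
  -- The second summand keeps `ε` positive even if `τ` is eventually zero.
  refine ⟨fun n => √(σ n) + 1 / ((n : ℝ) + 1), fun n m h => ?_, fun n => by positivity, ?_,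
    fun n => ?_⟩
  · have := hanti h
    dsimp only
    gcongr
  · simpa using ((Real.continuous_sqrt.tendsto 0).comp hlim).add
      (tendsto_one_div_add_atTop_nhds_zero_nat (𝕜 := ℝ))
  · refine (hle n).trans ?_
    rw [← Real.sqrt_le_left (by positivity)]
    exact le_add_of_nonneg_right (by positivity)

theorem mainTheorem2_of_mertens (hM : Tendsto (fun N : ℕ => (N : ℝ)⁻¹ *
      ∑ n ∈ Finset.range N, ((ArithmeticFunction.moebius (n + 1) : ℤ) : ℝ)) atTop (𝓝 0))
    (τ : ℕ → ℝ) (hτ : Tendsto τ atTop (𝓝 0)) :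
    ∃ (X : Type) (_ : MetricSpace X) (_ : CompactSpace X) (T : C(X, X)),
      HasZeroEntropy T ∧ MoebiusDisjoint T ∧
      ∃ (x : X) (f : C(X, ℝ)),
        ¬ (fun N : ℕ => moebiusAverage T f x N) =O[atTop] τ := by
  obtain ⟨ε, hanti, hpos, hlim, hle⟩ := exists_antitone_sq_ge_of_tendsto_zero hτ
  have ha : Tendsto (fun n : ℕ => ((ArithmeticFunction.moebius n : ℤ) : ℝ) * ε n)
      atTop (𝓝 0) := by
    refine squeeze_zero_norm (fun n => ?_) hlim
    rw [norm_mul, Real.norm_of_nonneg (hpos n).le]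
    refine mul_le_of_le_one_left (hpos n).le ?_
    rw [Real.norm_eq_abs]
    exact_mod_cast ArithmeticFunction.abs_moebius_le_one
  refine ⟨ℕ∞, TopologicalSpace.metrizableSpaceMetric ℕ∞, inferInstance, ENat.succMap,
    @ENat.coverEntropy_succMap
      (TopologicalSpace.metrizableSpaceMetric ℕ∞).toPseudoMetricSpace.toUniformSpace rfl, 
    .of_tendsto_iterate ENat.tendsto_succMap_iterate hM,
    0, ENat.extendByZero _ ha, fun hO => ?_⟩
  obtain ⟨C, hC⟩ := hO.bound
  have hlow (N : ℕ) (hN : 0 < N) :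
      ε N / 4 ≤ moebiusAverage ENat.succMap (ENat.extendByZero _ ha) 0 N := by
    have hN' : (0 : ℝ) < N := by exact_mod_cast hN
    rw [moebiusAverage_eq_range, ← div_eq_inv_mul, le_div_iff₀ hN']
    calc ε N / 4 * N = ε N * (N / 4) := by ring
      _ ≤ ε N * ∑ n ∈ Finset.range N, ((ArithmeticFunction.moebius (n + 1) : ℤ) : ℝ) ^ 2 :=
        mul_le_mul_of_nonneg_left (Nat.div_four_le_sum_sq_moebius N) (hpos N).le
      _ ≤ _ := by
        rw [Finset.mul_sum]
        refine Finset.sum_le_sum fun n hn => ?_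
        rw [ENat.succMap_iterate, zero_add, ENat.extendByZero_natCast, ← mul_assoc, ← sq, mul_comm]
        exact mul_le_mul_of_nonneg_left (hanti (Finset.mem_range.1 hn)) (sq_nonneg _)
  have hev : ∀ᶠ N : ℕ in atTop, (1 : ℝ) / 4 ≤ |C| * ε N := by
    filter_upwards [hC, eventually_gt_atTop 0] with N h hN
    have h1 := (hlow N hN).trans ((le_abs_self _).trans h)
    have h2 : C * ‖τ N‖ ≤ |C| * ε N ^ 2 :=
      mul_le_mul (le_abs_self C) (hle N) (norm_nonneg _) (abs_nonneg C)
    refine le_of_mul_le_mul_right ?_ (hpos N)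
    linarith
  have := ge_of_tendsto (hlim.const_mul |C|) hev
  norm_num at this

/-! ### A Tauberian theorem for slowly varying functions -/

theorem Real.fourier_comp_div (ψ : ℝ → ℂ) {c : ℝ} (hc : 0 < c) (u : ℝ) :
    𝓕 (fun ξ => ψ (ξ / c)) u = c * 𝓕 ψ (c * u) := by
  rw [Real.fourier_real_eq, Real.fourier_real_eq]
  have := Measure.integral_comp_div (fun ξ => Real.fourierChar (-(ξ * (c * u))) • ψ ξ) c
  rw [abs_of_pos hc, Complex.real_smul] at this
  rw [← this]
  congr 1 with ξ
  rw [← mul_assoc, div_mul_cancel₀ _ hc.ne']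

theorem Real.fourier_fourierChar_smul (ψ : ℝ → ℂ) (T u : ℝ) :
    𝓕 (fun ξ => Real.fourierChar (-(ξ * T)) • ψ ξ) u = 𝓕 ψ (u + T) := by
  rw [Real.fourier_real_eq, Real.fourier_real_eq]
  congr 1 with ξ
  rw [smul_smul, ← AddChar.map_add_eq_mul]
  congr 2
  ring

theorem integrable_exp_mul_of_bounded {h : ℝ → ℂ} (hm : Measurable h) (hb : ∀ u, ‖h u‖ ≤ 1)
    (h0 : ∀ u, 0 < u → h u = 0) {σ : ℝ} (hσ : 0 < σ) :
    Integrable (fun u : ℝ => (Real.exp (σ * u) : ℂ) * h u) := by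
  have hI : Integrable ((Set.Iic (0 : ℝ)).indicator fun u => Real.exp (σ * u)) :=
    (integrable_indicator_iff measurableSet_Iic).2 (integrableOn_exp_mul_Iic hσ 0)
  refine hI.mono (by fun_prop) (ae_of_all _ fun u => ?_)
  by_cases hu : 0 < u
  · simp [h0 u hu]
  · rw [Set.indicator_of_mem (Set.mem_Iic.2 (not_lt.1 hu)), norm_mul, Complex.norm_real]
    exact mul_le_of_le_one_right (norm_nonneg _) (hb u)

/-- A smooth bump equal to `1` at `0`: Fourier inversion at `0` gives the mass of `𝓕 ψ`, which
serves as a band-limited averaging kernel. -/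
theorem exists_hasCompactSupport_integral_fourier_eq_one :
    ∃ ψ : ℝ → ℂ, Continuous ψ ∧ HasCompactSupport ψ ∧
      Integrable (𝓕 ψ) ∧ ∫ v, 𝓕 ψ v = 1 := by
  let b : ContDiffBump (0 : ℝ) := ⟨1, 2, one_pos, one_lt_two⟩
  have hb0 : b 0 = 1 := b.one_of_mem_closedBall (Metric.mem_closedBall_self zero_le_one)
  have hc : HasCompactSupport fun x : ℝ => Complex.ofReal (b x) :=
    b.hasCompactSupport.comp_left (g := Complex.ofReal) Complex.ofReal_zero
  have hd : ContDiff ℝ ((⊤ : ℕ∞) : WithTop ℕ∞) fun x : ℝ => Complex.ofReal (b x) :=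
    Complex.ofRealCLM.contDiff.comp b.contDiff
  obtain ⟨f, hf⟩ : ∃ f : SchwartzMap ℝ ℂ, (f : ℝ → ℂ) = fun x => Complex.ofReal (b x) :=
    ⟨hc.toSchwartzMap hd, rfl⟩
  have hi : Integrable (𝓕 (f : ℝ → ℂ)) := by
    rw [← SchwartzMap.fourier_coe]; exact (𝓕 f).integrable
  refine ⟨f, f.continuous, hf ▸ hc, hi, ?_⟩
  have := congrFun (f.continuous.fourierInv_fourier_eq f.integrable hi) 0
  rw [Real.fourierInv_eq] at this
  simp only [inner_zero_right, AddChar.map_zero_eq_one, one_smul] at this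
  rw [this, congrFun hf 0, hb0, Complex.ofReal_one]

section Tauberian

variable {h : ℝ → ℂ} {K : ℝ → ℝ → ℂ} (hm : Measurable h) (hb : ∀ u, ‖h u‖ ≤ 1)
  (h0 : ∀ u, 0 < u → h u = 0)
  (hK : ContinuousOn (Function.uncurry K) (Set.Ici 0 ×ˢ Set.univ))
  (hF : ∀ σ, 0 < σ → ∀ ξ, 𝓕 (fun u : ℝ => (Real.exp (σ * u) : ℂ) * h u) ξ = K σ ξ)

include hm hb h0 hK hF

/-- For `σ > 0` the damped `h` is integrable and Fubini moves the transform from one factor to the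
other. Then `σ → 0⁺` by dominated convergence on both sides; compact support of `ψ` is what bounds
`K`. -/
theorem integral_mul_fourier_eq_fourier_boundary {ψ : ℝ → ℂ} (hψ : Continuous ψ)
    (hψc : HasCompactSupport ψ) (hψi : Integrable (𝓕 ψ)) (T : ℝ) :
    ∫ u, h u * 𝓕 ψ (u + T) = 𝓕 (fun ξ => K 0 ξ * ψ ξ) T := by
  set χ : ℝ → ℂ := fun ξ => Real.fourierChar (-(ξ * T)) • ψ ξ
  have hχ : Continuous χ := by fun_prop
  have hχn (ξ : ℝ) : ‖χ ξ‖ = ‖ψ ξ‖ := Circle.norm_smul _ _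
  have hψint : Integrable ψ := hψ.integrable_of_hasCompactSupport hψc
  have hχint : Integrable χ := hψint.mono hχ.aestronglyMeasurable (ae_of_all _ fun ξ => (hχn ξ).le)
  have hflip (σ : ℝ) (hσ : 0 < σ) :
      ∫ ξ, K σ ξ * χ ξ = ∫ u, (Real.exp (σ * u) : ℂ) * h u * 𝓕 ψ (u + T) := by
    have := VectorFourier.integral_fourierIntegral_smul_eq_flip (L := innerₗ ℝ)
      Real.continuous_fourierChar continuous_inner
      (integrable_exp_mul_of_bounded hm hb h0 hσ) hχint
    calc _ = ∫ ξ, 𝓕 (fun u : ℝ => (Real.exp (σ * u) : ℂ) * h u) ξ • χ ξ := by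
          simp_rw [hF σ hσ, smul_eq_mul]
      _ = ∫ u, ((Real.exp (σ * u) : ℂ) * h u) • 𝓕 χ u := by simpa using! this
      _ = _ := by simp_rw [χ, Real.fourier_fourierChar_smul, smul_eq_mul]
  have hK' (σ : ℝ) (hσ : 0 ≤ σ) : Continuous (K σ) := by
    rw [← continuousOn_univ]
    exact hK.comp (f := fun ξ => (σ, ξ)) (by fun_prop) fun ξ _ => ⟨hσ, trivial⟩
  obtain ⟨C, hC⟩ : ∃ C, ∀ σ ∈ Set.Icc (0 : ℝ) 1, ∀ ξ ∈ tsupport ψ, ‖K σ ξ‖ ≤ C := by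
    obtain ⟨C, hC⟩ := (isCompact_Icc.prod hψc).exists_bound_of_continuousOn
      (hK.mono (Set.prod_mono Set.Icc_subset_Ici_self (Set.subset_univ _)))
    exact ⟨C, fun σ hσ ξ hξ => hC (σ, ξ) ⟨hσ, hξ⟩⟩
  have hlim1 : Tendsto (fun σ => ∫ ξ, K σ ξ * χ ξ) (𝓝[>] 0) (𝓝 (∫ ξ, K 0 ξ * χ ξ)) := by
    refine tendsto_integral_filter_of_dominated_convergence (fun ξ => C * ‖ψ ξ‖) ?_ ?_
      (hψint.norm.const_mul C) (ae_of_all _ fun ξ => ?_)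
    · filter_upwards [self_mem_nhdsWithin] with σ hσ
      exact ((hK' σ (le_of_lt hσ)).mul hχ).aestronglyMeasurable
    · filter_upwards [Ioc_mem_nhdsGT zero_lt_one] with σ hσ
      refine ae_of_all _ fun ξ => ?_
      rw [norm_mul, hχn]
      by_cases hξ : ξ ∈ tsupport ψ
      · exact mul_le_mul_of_nonneg_right (hC σ ⟨hσ.1.le, hσ.2⟩ ξ hξ) (norm_nonneg _)
      · simp [image_eq_zero_of_notMem_tsupport hξ]
    · refine Tendsto.mul_const _ ?_
      refine (hK (0, ξ) ⟨Set.mem_Ici.2 le_rfl, trivial⟩).tendsto.comp (f := fun σ : ℝ => (σ, ξ))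
        (tendsto_nhdsWithin_iff.2 ⟨?_, ?_⟩)
      · exact (Continuous.tendsto (by fun_prop) 0).mono_left nhdsWithin_le_nhds
      · filter_upwards [self_mem_nhdsWithin] with σ hσ using ⟨Set.mem_Ici.2 (le_of_lt hσ), trivial⟩
  have hlim2 : Tendsto (fun σ : ℝ => ∫ u, (Real.exp (σ * u) : ℂ) * h u * 𝓕 ψ (u + T)) (𝓝[>] 0)
      (𝓝 (∫ u, h u * 𝓕 ψ (u + T))) := by
    have hi : Integrable fun u => 𝓕 ψ (u + T) := hψi.comp_add_right T
    refine tendsto_integral_filter_of_dominated_convergence (fun u => ‖𝓕 ψ (u + T)‖) ?_ ?_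
      hi.norm (ae_of_all _ fun u => ?_)
    · filter_upwards with σ
      exact AEStronglyMeasurable.mul (by fun_prop) hi.aestronglyMeasurable
    · filter_upwards [self_mem_nhdsWithin] with σ hσ
      refine ae_of_all _ fun u => ?_
      rw [norm_mul]
      refine mul_le_of_le_one_left (norm_nonneg _) ?_
      by_cases hu : 0 < u
      · simp [h0 u hu]
      · rw [norm_mul, Complex.norm_real, Real.norm_of_nonneg (Real.exp_pos _).le]
        exact mul_le_one₀ (Real.exp_le_one_iff.2
          (mul_nonpos_of_nonneg_of_nonpos (le_of_lt hσ) (not_lt.1 hu))) (norm_nonneg _) (hb u)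
    · have : Continuous fun σ : ℝ => (Real.exp (σ * u) : ℂ) * h u * 𝓕 ψ (u + T) := by fun_prop
      simpa using (this.tendsto 0).mono_left nhdsWithin_le_nhds
  have heq := tendsto_nhds_unique (hlim1.congr' ?_) hlim2
  · rw [← heq, Real.fourier_real_eq]
    congr 1 with ξ
    simp only [χ, Circle.smul_def, smul_eq_mul]
    ring
  · filter_upwards [self_mem_nhdsWithin] with σ hσ using hflip σ hσ

/-- A bounded, slowly varying function on the negative half-line whose Laplace transform extends
continuously to the boundary tends to zero. -/
theorem tendsto_zero_of_fourier_boundary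
    (hslow : ∀ T w, ‖h (T + w) - h T‖ ≤ 2 * |1 - Real.exp (-w)| + Real.exp T) :
    Tendsto h atBot (𝓝 0) := by
  obtain ⟨ψ, hψ, hψc, hψi, hψ1⟩ : ∃ ψ : ℝ → ℂ, Continuous ψ ∧ HasCompactSupport ψ ∧
      Integrable (𝓕 ψ) ∧ ∫ v, 𝓕 ψ v = 1 :=
    exists_hasCompactSupport_integral_fourier_eq_one
  set φ := 𝓕 ψ
  have hshift (c : ℝ) (hc : 0 < c) (T : ℝ) :
      ∫ u, h u * 𝓕 (fun ξ => ψ (ξ / c)) (u + -T) = ∫ v, h (T + v / c) * φ v := by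
    simp_rw [Real.fourier_comp_div ψ hc]
    have h1 := Measure.integral_comp_div (fun v => h (T + v) * φ (c * v)) c
    rw [abs_of_pos hc, Complex.real_smul] at h1
    have h2 := integral_add_right_eq_self (μ := volume) (fun u => h u * (c * φ (c * (u + -T)))) T
    rw [← h2]
    calc _ = c * ∫ v, h (T + v) * φ (c * v) := by
          rw [← integral_const_mul]
          congr 1 with v
          rw [add_neg_cancel_right, add_comm]
          ring
      _ = _ := by
          rw [← h1]
          congr 1 with v
          rw [mul_div_cancel₀ _ hc.ne']
  -- Riemann–Lebesgue for `K 0 ξ * ψ (ξ / c)`.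
  have hA (c : ℝ) (hc : 0 < c) : Tendsto (fun T => ∫ v, h (T + v / c) * φ v) atBot (𝓝 0) := by
    have hcs : HasCompactSupport fun ξ => ψ (ξ / c) := by
      simpa [div_eq_mul_inv, Function.comp_def] using
        hψc.comp_homeomorph (Homeomorph.mulRight₀ c⁻¹ (inv_ne_zero hc.ne'))
    have hi : Integrable (𝓕 fun ξ => ψ (ξ / c)) := by
      rw [funext (Real.fourier_comp_div ψ hc)]
      exact (hψi.comp_mul_left' hc.ne').const_mul _
    have := (Real.zero_at_infty_fourier fun ξ => K 0 ξ * ψ (ξ / c)).comp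
      (tendsto_neg_atBot_atTop.mono_right atTop_le_cocompact)
    refine this.congr fun T => ?_
    rw [← hshift c hc, Function.comp,
      integral_mul_fourier_eq_fourier_boundary hm hb h0 hK hF (by fun_prop) hcs hi]
  -- Smoothing error at scale `1/c`; the cap `2`, from `‖h‖ ≤ 1`, provides the dominating function.
  set D : ℝ → ℝ := fun c => ∫ v, min 2 (2 * |1 - Real.exp (-(v / c))|) * ‖φ v‖
  have hDint (c : ℝ) : Integrable fun v => min 2 (2 * |1 - Real.exp (-(v / c))|) * ‖φ v‖ := by
    refine (hψi.norm.const_mul 2).mono ?_ (ae_of_all _ fun v => ?_)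
    · exact AEStronglyMeasurable.mul (by fun_prop) hψi.norm.aestronglyMeasurable
    · rw [norm_mul, norm_mul, Real.norm_of_nonneg (by positivity), Real.norm_of_nonneg zero_le_two]
      exact mul_le_mul_of_nonneg_right (min_le_left _ _) (norm_nonneg _)
  have hD : Tendsto D atTop (𝓝 0) := by
    rw [← integral_zero ℝ ℝ (μ := volume)]
    refine tendsto_integral_filter_of_dominated_convergence (fun v => 2 * ‖φ v‖)
      (Eventually.of_forall fun c => (hDint c).aestronglyMeasurable)
      (Eventually.of_forall fun c => ae_of_all _ fun v => ?_) (hψi.norm.const_mul 2)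
      (ae_of_all _ fun v => ?_)
    · rw [norm_mul, norm_norm, Real.norm_of_nonneg (by positivity)]
      exact mul_le_mul_of_nonneg_right (min_le_left _ _) (norm_nonneg _)
    · have h1 : Tendsto (fun c : ℝ => v / c) atTop (𝓝 0) := tendsto_const_nhds.div_atTop tendsto_id
      have h2 : Continuous fun w : ℝ => min 2 (2 * |1 - Real.exp (-w)|) * ‖φ v‖ := by fun_prop
      simpa [Function.comp_def] using (h2.tendsto 0).comp h1
  have hbound (c : ℝ) (T : ℝ) :
      ‖h T‖ ≤ ‖∫ v, h (T + v / c) * φ v‖ + (D c + Real.exp T * ∫ v, ‖φ v‖) := by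
    have hi1 : Integrable fun v => h (T + v / c) * φ v := by
      refine hψi.mono ?_ (ae_of_all _ fun v => ?_)
      · exact (hm.comp (by fun_prop)).aestronglyMeasurable.mul hψi.aestronglyMeasurable
      · rw [norm_mul]; exact mul_le_of_le_one_left (norm_nonneg _) (hb _)
    have hi2 : Integrable fun v => h T * φ v := hψi.const_mul _
    have e1 : h T = ∫ v, h T * φ v := by rw [integral_const_mul, hψ1, mul_one]
    have e2 : h T = (∫ v, h (T + v / c) * φ v) - ∫ v, (h (T + v / c) - h T) * φ v := by
      simp_rw [sub_mul]
      rw [integral_sub hi1 hi2, ← e1, sub_sub_cancel]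
    rw [e2]
    refine (norm_sub_le _ _).trans (add_le_add_right ?_ _)
    rw [← integral_const_mul, ← integral_add (hDint c) (hψi.norm.const_mul _)]
    refine norm_integral_le_of_norm_le ((hDint c).add (hψi.norm.const_mul _))
      (ae_of_all _ fun v => ?_)
    rw [norm_mul, ← add_mul]
    refine mul_le_mul_of_nonneg_right ?_ (norm_nonneg _)
    have h2 : ‖h (T + v / c) - h T‖ ≤ 2 :=
      (norm_sub_le _ _).trans (by linarith [hb (T + v / c), hb T])
    rw [← min_add_add_right]
    exact le_min (h2.trans (by linarith [Real.exp_pos T])) (hslow T _)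
  rw [Metric.tendsto_nhds]
  intro ε hε
  -- The scale `c` is fixed before `T → -∞`.
  obtain ⟨c, hcD, hc⟩ := ((Metric.tendsto_nhds.1 hD (ε / 2) (half_pos hε)).and
    (eventually_gt_atTop 0)).exists
  have hlim : Tendsto (fun T => ‖∫ v, h (T + v / c) * φ v‖ + (D c + Real.exp T * ∫ v, ‖φ v‖))
      atBot (𝓝 (D c)) := by
    simpa using (hA c hc).norm.add ((Real.tendsto_exp_atBot.mul_const (∫ v, ‖φ v‖)).const_add (D c))
  have hDc : D c < ε := by
    rw [Real.dist_0_eq_abs] at hcD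
    linarith [le_abs_self (D c)]
  filter_upwards [hlim.eventually_lt_const hDc] with T hT
  rw [dist_zero_right]
  exact (hbound c T).trans_lt hT

end Tauberian

/-! ### The Mertens function -/

/-- The Mertens function `M(x) = ∑_{n ≤ x} μ(n)`. -/
noncomputable def mertens (x : ℝ) : ℂ :=
  ∑ k ∈ Finset.Icc 1 ⌊x⌋₊, ((ArithmeticFunction.moebius k : ℤ) : ℂ)

theorem norm_moebius_le_one (n : ℕ) : ‖((ArithmeticFunction.moebius n : ℤ) : ℂ)‖ ≤ 1 := by
  rw [Complex.norm_intCast]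
  exact_mod_cast ArithmeticFunction.abs_moebius_le_one

theorem measurable_mertens : Measurable mertens :=
  (measurable_from_nat (f := fun N : ℕ =>
    ∑ k ∈ Finset.Icc 1 N, ((ArithmeticFunction.moebius k : ℤ) : ℂ))).comp Nat.measurable_floor

theorem mertens_of_lt_one {x : ℝ} (hx : x < 1) : mertens x = 0 := by
  simp [mertens, Nat.floor_eq_zero.2 hx]

theorem norm_mertens_le {x : ℝ} (hx : 0 ≤ x) : ‖mertens x‖ ≤ x := by
  refine (norm_sum_le_of_le _ fun n _ => norm_moebius_le_one n).trans ?_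
  simpa using Nat.floor_le hx

theorem norm_mertens_sub_le {x y : ℝ} (hx : 0 ≤ x) (hy : 0 ≤ y) :
    ‖mertens y - mertens x‖ ≤ |y - x| + 1 := by
  wlog h : x ≤ y generalizing x y
  · rw [norm_sub_rev, abs_sub_comm]
    exact this hy hx (le_of_not_ge h)
  have hfl : ⌊x⌋₊ ≤ ⌊y⌋₊ := Nat.floor_le_floor h
  have hsub : Finset.Icc 1 ⌊x⌋₊ ⊆ Finset.Icc 1 ⌊y⌋₊ := Finset.Icc_subset_Icc_right hfl
  rw [mertens, mertens, ← Finset.sum_sdiff hsub, add_sub_cancel_right]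
  refine (norm_sum_le_of_le _ fun n _ => norm_moebius_le_one n).trans ?_
  rw [Finset.sum_const, nsmul_one, Finset.card_sdiff_of_subset hsub, Nat.card_Icc, Nat.card_Icc,
    Nat.add_sub_cancel, Nat.add_sub_cancel, Nat.cast_sub hfl, abs_of_nonneg (sub_nonneg.2 h)]
  linarith [Nat.floor_le hy, Nat.lt_floor_add_one x]

/-- The function `s ↦ 1 / (s ζ(s))`, with its continuous extension to `s = 1`. -/
noncomputable def invMulZeta (s : ℂ) : ℂ :=
  (s - 1) / (s * Function.update (fun z => (z - 1) * riemannZeta z) 1 1 s)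

theorem invMulZeta_of_ne_one {s : ℂ} (hs : s ≠ 1) : invMulZeta s = (s * riemannZeta s)⁻¹ := by
  rw [invMulZeta, Function.update_of_ne hs, mul_left_comm, ← div_div,
    div_self (sub_ne_zero.2 hs), one_div]

/-- Rests on the nonvanishing of `ζ` on `Re s ≥ 1`; at `s = 1` the residue `1` makes the updated
factor continuous and nonzero. -/
theorem continuousAt_invMulZeta {s : ℂ} (hs : 1 ≤ s.re) : ContinuousAt invMulZeta s := by
  have h0 : s ≠ 0 := by
    rintro rfl
    norm_num at hs
  refine ContinuousAt.div (by fun_prop) (continuousAt_id.mul ?_) (mul_ne_zero h0 ?_)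
  · rcases eq_or_ne s 1 with rfl | h1
    · exact continuousAt_update_same.2 riemannZeta_residue_one
    · rw [continuousAt_update_of_ne h1]
      exact (by fun_prop : ContinuousAt (fun z : ℂ => z - 1) s).mul
        (differentiableAt_riemannZeta h1).continuousAt
  · rcases eq_or_ne s 1 with rfl | h1
    · simp
    · rw [Function.update_of_ne h1]
      exact mul_ne_zero (sub_ne_zero.2 h1) (riemannZeta_ne_zero_of_one_le_re hs)

/-- Partial summation of `∑ μ(n) n^{-s}`, combined with `ζ(s) ∑ μ(n) n^{-s} = 1`. -/
theorem mellin_mertens {s : ℂ} (hs : 1 < s.re) : mellin mertens (-s) = invMulZeta s := by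
  have h1 : s ≠ 1 := by
    rintro rfl
    norm_num at hs
  have hO : (fun n => ∑ k ∈ Finset.Icc 1 n, ((ArithmeticFunction.moebius k : ℤ) : ℂ))
      =O[atTop] fun n => (n : ℝ) ^ (1 : ℝ) := by
    refine isBigO_of_le _ fun n => ?_
    simpa [mertens] using norm_mertens_le (Nat.cast_nonneg n)
  have hL := LSeries_eq_mul_integral (fun n => ((ArithmeticFunction.moebius n : ℤ) : ℂ))
    zero_le_one hs (ArithmeticFunction.LSeriesSummable_moebius_iff.2 hs) hO
  have hζ := ArithmeticFunction.LSeries_zeta_mul_Lseries_moebius hs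
  rw [ArithmeticFunction.LSeries_zeta_eq_riemannZeta hs] at hζ
  have hint : mellin mertens (-s) = ∫ t in Set.Ioi (1 : ℝ), mertens t * (t : ℂ) ^ (-(s + 1)) := by
    rw [mellin, ← setIntegral_eq_of_subset_of_ae_sdiff_eq_zero (s := Set.Ioi (1 : ℝ))
      measurableSet_Ioi.nullMeasurableSet (Set.Ioi_subset_Ioi zero_le_one)]
    · refine setIntegral_congr_fun measurableSet_Ioi fun t _ => ?_
      simp only [smul_eq_mul]
      rw [mul_comm]
      congr 2
      ring
    · have : ∀ᵐ t : ℝ, t ≠ 1 := by simp [ae_iff]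
      filter_upwards [this] with t ht ht'
      rw [mertens_of_lt_one (lt_of_le_of_ne (not_lt.1 ht'.2) ht), zero_mul]
  rw [invMulZeta_of_ne_one h1, hint]
  refine eq_inv_of_mul_eq_one_right ?_
  rw [hL, mul_left_comm, ← mul_assoc] at hζ
  exact hζ

/-- The prime number theorem, in the form `M(x) = o(x)`. -/
theorem tendsto_exp_mul_mertens_exp_neg :
    Tendsto (fun u : ℝ => (Real.exp u : ℂ) * mertens (Real.exp (-u))) atBot (𝓝 0) := by
  have hexp (u : ℝ) : ‖(Real.exp u : ℂ)‖ = Real.exp u := by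
    rw [Complex.norm_real, Real.norm_of_nonneg (Real.exp_pos u).le]
  have hmul (u : ℝ) : Real.exp u * Real.exp (-u) = 1 := by rw [← Real.exp_add]; simp
  refine tendsto_zero_of_fourier_boundary
    (K := fun σ ξ => invMulZeta (1 + σ - 2 * Real.pi * ξ * Complex.I)) ?_ ?_ ?_ ?_ ?_ ?_
  · exact Measurable.mul (by fun_prop) (measurable_mertens.comp (by fun_prop))
  · intro u
    rw [norm_mul, hexp, ← hmul u]
    gcongr
    exact norm_mertens_le (Real.exp_pos _).le
  · intro u hu
    rw [mertens_of_lt_one (Real.exp_lt_one_iff.2 (neg_lt_zero.2 hu)), mul_zero]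
  · rintro ⟨σ, ξ⟩ ⟨hσ, -⟩
    refine ContinuousAt.continuousWithinAt ?_
    refine ContinuousAt.comp (g := invMulZeta) (continuousAt_invMulZeta ?_)
      (f := fun p : ℝ × ℝ => 1 + (p.1 : ℂ) - 2 * Real.pi * p.2 * Complex.I) (by fun_prop)
    simpa using hσ
  · intro σ hσ ξ
    rw [← mellin_mertens (by simpa using hσ), mellin_eq_fourier]
    have hξ : (-(1 + (σ : ℂ) - 2 * Real.pi * ξ * Complex.I)).im / (2 * Real.pi) = ξ := by
      simp [Real.pi_ne_zero]
    rw [hξ]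
    refine congrFun (congrArg _ (funext fun u => ?_)) ξ
    rw [← mul_assoc, ← Complex.ofReal_mul, ← Real.exp_add, Complex.real_smul]
    congr 3
    simp
    ring
  · intro T w
    have hT := hmul T
    have hw := hmul w
    -- The change of weight and the change of `M` each cost `|1 - e^{-w}|`; the rounding `+ 1` in
    -- the latter yields the `e^T` term.
    have e : (Real.exp (T + w) : ℂ) * mertens (Real.exp (-(T + w))) -
        Real.exp T * mertens (Real.exp (-T)) = Real.exp T *
        (((Real.exp w - 1 : ℝ) : ℂ) * mertens (Real.exp (-(T + w))) +
          (mertens (Real.exp (-(T + w))) - mertens (Real.exp (-T)))) := by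
      rw [Real.exp_add]
      push_cast
      ring
    rw [e, norm_mul, hexp]
    have h1 := norm_mertens_le (Real.exp_pos (-(T + w))).le
    have h2 := norm_mertens_sub_le (Real.exp_pos (-T)).le (Real.exp_pos (-(T + w))).le
    have h3 : Real.exp (-(T + w)) = Real.exp (-T) * Real.exp (-w) := by
      rw [← Real.exp_add]; ring_nf
    have h4 : Real.exp w - 1 = Real.exp w * (1 - Real.exp (-w)) := by rw [mul_sub, hw, mul_one]
    have h5 : |Real.exp (-(T + w)) - Real.exp (-T)| = Real.exp (-T) * |1 - Real.exp (-w)| := by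
      rw [h3, ← mul_sub_one, abs_mul, abs_of_pos (Real.exp_pos _), abs_sub_comm]
    have h6 : |Real.exp w - 1| * Real.exp (-(T + w)) = Real.exp (-T) * |1 - Real.exp (-w)| := by
      rw [h4, abs_mul, abs_of_pos (Real.exp_pos _), h3]
      linear_combination (Real.exp (-T) * |1 - Real.exp (-w)|) * hw
    calc _ ≤ Real.exp T * (|Real.exp w - 1| * Real.exp (-(T + w)) +
          (|Real.exp (-(T + w)) - Real.exp (-T)| + 1)) := by
          gcongr
          refine (norm_add_le _ _).trans (add_le_add ?_ h2)
          rw [norm_mul, Complex.norm_real, Real.norm_eq_abs]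
          gcongr
      _ = _ := by
          rw [h5, h6]
          linear_combination (2 * |1 - Real.exp (-w)|) * hT

theorem tendsto_inv_mul_sum_moebius :
    Tendsto (fun N : ℕ => (N : ℝ)⁻¹ *
      ∑ n ∈ Finset.range N, ((ArithmeticFunction.moebius (n + 1) : ℤ) : ℝ)) atTop (𝓝 0) := by
  have h := tendsto_exp_mul_mertens_exp_neg.comp (tendsto_neg_atTop_atBot.comp
    (Real.tendsto_log_atTop.comp tendsto_natCast_atTop_atTop))
  rw [tendsto_zero_iff_norm_tendsto_zero] at h ⊢
  refine h.congr' ?_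
  filter_upwards [eventually_gt_atTop 0] with N hN
  have hN' : (0 : ℝ) < N := by exact_mod_cast hN
  simp only [Function.comp_apply, Real.exp_neg, inv_inv, Real.exp_log hN']
  have hM : mertens N = ((∑ n ∈ Finset.range N,
      ((ArithmeticFunction.moebius (n + 1) : ℤ) : ℝ) : ℝ) : ℂ) := by
    rw [mertens, Nat.floor_natCast, Finset.range_eq_Ico, Finset.sum_Ico_add'
      (fun n : ℕ => ((ArithmeticFunction.moebius n : ℤ) : ℝ)), zero_add]
    push_cast
    rfl
  rw [hM, ← Complex.ofReal_mul, Complex.norm_real]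

theorem mainTheorem2 (τ : ℕ → ℝ) (hτ : Tendsto τ atTop (𝓝 0)) :
    ∃ (X : Type) (_ : MetricSpace X) (_ : CompactSpace X) (T : C(X, X)),
      HasZeroEntropy T ∧ MoebiusDisjoint T ∧
      ∃ (x : X) (f : C(X, ℝ)),
        ¬ (fun N : ℕ => moebiusAverage T f x N) =O[atTop] τ :=
  mainTheorem2_of_mertens tendsto_inv_mul_sum_moebius τ hτ
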